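/- Let $V$ be a vertex operator algebra over $\mathbb{C}$ and let $W_1,\dots,W_r$ be pairwise inequivalent irreducible $V$-modules, where a $V$-module is graded by $L(0)$-eigenvalues, $W=\bigoplus_{h\in\mathbb{C}}W_{(h)}$, with $\dim W_{(h)}<\infty$ and, for each $h$, $W_{(h+n)}=0$ for $n\in\mathbb{Z}$ sufficiently small. Let $A=\bigoplus_{m\in\mathbb{Z}}A_m$ be the free associative unital algebra on $V\otimes\mathbb{C}[t,t^{-1}]$, graded by $\deg(v\otimes t^n)=\mathrm{wt}\,v-n-1$ for homogeneous $v$. Put $A_{m,k}=\sum_{n>k}A_{m+n}A_{-n}$, let $\tilde A_m$ be the completion of $A_m$ with respect to the topology having the $A_{m,k}$ $(k\in\mathbb{Z})$ as basic neighbourhoods of $0$, and let $\tilde A=\bigoplus_m\tilde A_m$. Writing $v(n)=v\otimes t^n$, let $U(V)=\tilde A/\mathrm{Jac}$ be the universal enveloping algebra of $V$, where $\mathrm{Jac}$ is the two-sided ideal generated by the relations $\mathbf 1(n)=\delta_{n,-1}$, $(L(-1)u)(n)=-n\,u(n-1)$ and $$\sum_{i\ge0}(-1)^i\binom li u(m+l-i)v(n+i)-\sum_{i\ge0}(-1)^{l+i}\binom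 li v(n+l-i)u(m+i)=\sum_{i\ge0}\binom mi(u_{l+i}v)(m+n-i)$$ for $u,v\in V$ and $l,m,n\in\mathbb{Z}$. It acts continuously on every $V$-module, $u(n)$ acting as $u_n$. For a $V$-module $W$ let $gl_J(W)=\bigoplus_{k\in\mathbb{Z}}gl_J(W)_k\subset\mathrm{End}\,W$, where $gl_J(W)_k=\{f: fW_{(h)}\subset W_{(h+k)}\text{ for all }h\}=\prod_h\mathrm{Hom}(W_{(h)},W_{(h+k)})$ carries the product of the discrete topologies. Let $I=\bigcap_{i=1}^r\mathrm{ann}_{U(V)}W_i$. Then the actions of $U(V)$ on $W_1,\dots,W_r$ induce an isomorphism of $\mathbb{C}$-algebras $$U(V)/I\;\cong\;gl_J(W_1)\oplus\cdots\oplus gl_J(W_r).$$ This isomorphism preserves the $\mathbb{Z}$-gradings, and in each degree it is a homeomorphism (for the quotient topology on the left). -/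

import Mathlib

set_option linter.unusedSectionVars false

open scoped TensorProduct LaurentPolynomial
open Filter
open VertexOperator (ncoeff)

noncomputable section

/-! ## The completion of a `ℤ`-graded associative algebra -/

namespace GradedCompletion

section Completion

variable {R A : Type*} [CommRing R] [Ring A] [Algebra R A] (𝒜 : ℤ → Submodule R A)

/-- `A_{m,k} = ∑_{n > k} A_{m+n} A_{-n}`, a subspace of `A_m`. -/
def sub (m k : ℤ) : Submodule R A := ⨆ n : ℤ, ⨆ _ : k < n, 𝒜 (m + n) * 𝒜 (-n)

/-- `∑_m A_{m,k}`. -/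
def nhd (k : ℤ) : Submodule R A := ⨆ m : ℤ, sub 𝒜 m k

/-- `⨁_{|m| ≤ N} A_m`. -/
def bdd (N : ℕ) : Submodule R A := ⨆ m : ℤ, ⨆ _ : |m| ≤ (N : ℤ), 𝒜 m

variable {𝒜}

theorem sub_anti (m : ℤ) {k l : ℤ} (h : k ≤ l) : sub 𝒜 m l ≤ sub 𝒜 m k :=
  iSup_mono fun _ => iSup_mono' fun hn => ⟨lt_of_le_of_lt h hn, le_rfl⟩

theorem nhd_anti {k l : ℤ} (h : k ≤ l) : nhd 𝒜 l ≤ nhd 𝒜 k :=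
  iSup_mono fun m => sub_anti m h

theorem bdd_mono {N M : ℕ} (h : N ≤ M) : bdd 𝒜 N ≤ bdd 𝒜 M :=
  iSup_mono fun _ => iSup_mono' fun hm => ⟨hm.trans (by exact_mod_cast h), le_rfl⟩

theorem le_bdd (m : ℤ) : 𝒜 m ≤ bdd 𝒜 m.natAbs :=
  le_iSup₂_of_le (f := fun (m' : ℤ) (_ : |m'| ≤ (m.natAbs : ℤ)) => 𝒜 m') m (by simp) le_rfl

theorem mul_le_nhd {p q k : ℤ} (h : q < -k) : 𝒜 p * 𝒜 q ≤ nhd 𝒜 k := by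
  refine le_iSup_of_le (p + q) (le_iSup₂_of_le (-q) (by lia) ?_)
  rw [neg_neg, add_assoc, add_neg_cancel, add_zero]

variable [SetLike.GradedMonoid 𝒜]

theorem deg_mul_le (p q : ℤ) : 𝒜 p * 𝒜 q ≤ 𝒜 (p + q) :=
  Submodule.mul_le.2 fun _ ha _ hb => SetLike.mul_mem_graded ha hb

theorem bdd_mul_le (N M : ℕ) : bdd 𝒜 N * bdd 𝒜 M ≤ bdd 𝒜 (N + M) := by
  rw [bdd, bdd, Submodule.iSup_mul]
  refine iSup_le fun p => ?_
  rw [Submodule.iSup_mul]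
  refine iSup_le fun hp => ?_
  rw [Submodule.mul_iSup]
  refine iSup_le fun q => ?_
  rw [Submodule.mul_iSup]
  refine iSup_le fun hq => ?_
  refine (deg_mul_le p q).trans (le_iSup_of_le (p + q) (le_iSup_of_le ?_ le_rfl))
  push_cast
  exact (abs_add_le p q).trans (add_le_add hp hq)

theorem bdd_mul_nhd_le (N : ℕ) (k : ℤ) : bdd 𝒜 N * nhd 𝒜 k ≤ nhd 𝒜 k := by
  rw [bdd, Submodule.iSup_mul]
  refine iSup_le fun p => ?_
  rw [Submodule.iSup_mul]
  refine iSup_le fun _ => ?_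
  conv_lhs => rw [nhd, Submodule.mul_iSup]
  refine iSup_le fun m => ?_
  rw [sub, Submodule.mul_iSup]
  refine iSup_le fun n => ?_
  rw [Submodule.mul_iSup]
  refine iSup_le fun hn => ?_
  rw [← mul_assoc]
  refine (mul_le_mul_left (deg_mul_le p (m + n)) _).trans ?_
  exact mul_le_nhd (by lia)

theorem nhd_mul_bdd_le (N : ℕ) (k : ℤ) : nhd 𝒜 (k + N) * bdd 𝒜 N ≤ nhd 𝒜 k := by
  rw [bdd, Submodule.mul_iSup]
  refine iSup_le fun p => ?_
  rw [Submodule.mul_iSup]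
  refine iSup_le fun hp => ?_
  conv_lhs => rw [nhd, Submodule.iSup_mul]
  refine iSup_le fun m => ?_
  rw [sub, Submodule.iSup_mul]
  refine iSup_le fun n => ?_
  rw [Submodule.iSup_mul]
  refine iSup_le fun hn => ?_
  have h2 := abs_le.1 hp
  rw [mul_assoc]
  refine (mul_le_mul_right (deg_mul_le (-n) p) _).trans ?_
  exact mul_le_nhd (by lia)

variable (𝒜)

/-- A Cauchy sequence of `⨁_m C(A_m)`: it lies in finitely many degrees and, for every `k`, its
differences eventually lie in `∑_m A_{m,k}`.  -/
def IsCauchySeq (f : ℕ → A) : Prop :=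
  (∃ N : ℕ, ∀ i, f i ∈ bdd 𝒜 N) ∧
    ∀ k : ℤ, ∃ r : ℕ, ∀ i, r ≤ i → ∀ j, r ≤ j → f i - f j ∈ nhd 𝒜 k

variable {𝒜}

theorem IsCauchySeq.mul {f g : ℕ → A} (hf : IsCauchySeq 𝒜 f) (hg : IsCauchySeq 𝒜 g) :
    IsCauchySeq 𝒜 (f * g) := by
  obtain ⟨⟨N, hN⟩, hf⟩ := hf
  obtain ⟨⟨M, hM⟩, hg⟩ := hg
  refine ⟨⟨N + M, fun i => bdd_mul_le N M (Submodule.mul_mem_mul (hN i) (hM i))⟩, fun k => ?_⟩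
  obtain ⟨r, hr⟩ := hf (k + M)
  obtain ⟨s, hs⟩ := hg k
  refine ⟨max r s, fun i hi j hj => ?_⟩
  have : (f * g) i - (f * g) j = (f i - f j) * g i + f j * (g i - g j) := by
    simp only [Pi.mul_apply]; noncomm_ring
  rw [this]
  exact add_mem
    (nhd_mul_bdd_le M k (Submodule.mul_mem_mul
      (hr i (le_of_max_le_left hi) j (le_of_max_le_left hj)) (hM i)))
    (bdd_mul_nhd_le N k (Submodule.mul_mem_mul (hN j)
      (hs i (le_of_max_le_right hi) j (le_of_max_le_right hj))))

theorem IsCauchySeq.add {f g : ℕ → A} (hf : IsCauchySeq 𝒜 f) (hg : IsCauchySeq 𝒜 g) :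
    IsCauchySeq 𝒜 (f + g) := by
  obtain ⟨⟨N, hN⟩, hf⟩ := hf
  obtain ⟨⟨M, hM⟩, hg⟩ := hg
  refine ⟨⟨max N M, fun i => add_mem (bdd_mono (le_max_left _ _) (hN i))
    (bdd_mono (le_max_right _ _) (hM i))⟩, fun k => ?_⟩
  obtain ⟨r, hr⟩ := hf k
  obtain ⟨s, hs⟩ := hg k
  refine ⟨max r s, fun i hi j hj => ?_⟩
  have : (f + g) i - (f + g) j = (f i - f j) + (g i - g j) := by
    simp only [Pi.add_apply]; abel
  rw [this]
  exact add_mem (hr i (le_of_max_le_left hi) j (le_of_max_le_left hj))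
    (hs i (le_of_max_le_right hi) j (le_of_max_le_right hj))

theorem isCauchySeq_const {a : A} {m : ℤ} (ha : a ∈ 𝒜 m) : IsCauchySeq 𝒜 fun _ => a :=
  ⟨⟨_, fun _ => le_bdd m ha⟩, fun _ => ⟨0, fun _ _ _ _ => by simp⟩⟩

variable (𝒜)

/-- The algebra `⨁_m C(A_m)` of Cauchy sequences, with pointwise operations. -/
def cauchySeq : Subalgebra R (ℕ → A) where
  carrier := {f | IsCauchySeq 𝒜 f}
  mul_mem' := IsCauchySeq.mul
  add_mem' := IsCauchySeq.add
  algebraMap_mem' c := by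
    have h : algebraMap R A c ∈ 𝒜 0 := by
      rw [Algebra.algebraMap_eq_smul_one]
      exact Submodule.smul_mem _ _ SetLike.GradedOne.one_mem
    exact isCauchySeq_const h

/-- The two-sided ideal of Cauchy sequences that are equivalent to `0`: for every `k` the terms
eventually lie in `∑_m A_{m,k}`. -/
def nullSeq : Ideal (cauchySeq 𝒜) where
  carrier := {f | ∀ k : ℤ, ∃ r : ℕ, ∀ i, r ≤ i → f.1 i ∈ nhd 𝒜 k}
  zero_mem' k := ⟨0, fun _ _ => by simp⟩
  add_mem' {f g} hf hg k := by
    obtain ⟨r, hr⟩ := hf k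
    obtain ⟨s, hs⟩ := hg k
    exact ⟨max r s, fun i hi => add_mem (hr i (le_of_max_le_left hi))
      (hs i (le_of_max_le_right hi))⟩
  smul_mem' f g hg k := by
    obtain ⟨r, hr⟩ := hg k
    obtain ⟨N, hN⟩ := f.2.1
    exact ⟨r, fun i hi => bdd_mul_nhd_le N k (Submodule.mul_mem_mul (hN i) (hr i hi))⟩

instance : (nullSeq 𝒜).IsTwoSided where
  mul_mem_of_left {f} g hf k := by
    obtain ⟨N, hN⟩ := g.2.1
    obtain ⟨r, hr⟩ := hf (k + N)
    exact ⟨r, fun i hi => nhd_mul_bdd_le N k (Submodule.mul_mem_mul (hr i hi) (hN i))⟩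

/-- The completion `Ã = ⨁_m Ã_m`: Cauchy sequences modulo equivalence. -/
abbrev Completion : Type _ := cauchySeq 𝒜 ⧸ nullSeq 𝒜

/-- The class of a Cauchy sequence. -/
def Completion.mk : cauchySeq 𝒜 →ₐ[R] Completion 𝒜 := Ideal.Quotient.mkₐ R (nullSeq 𝒜)

/-- The classes of the Cauchy sequences with terms in a subspace `P`.  For `P = A_m` this is the
homogeneous subspace `Ã_m`; for `P = A_{m,k}` it is the closure of (the image of) `A_{m,k}`, and
these are the basic neighbourhoods of `0` in `Ã_m`. -/
def Completion.ofSub (P : Submodule R A) : Submodule R (Completion 𝒜) where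
  carrier := {x | ∃ f : cauchySeq 𝒜, (∀ i, f.1 i ∈ P) ∧ Completion.mk 𝒜 f = x}
  zero_mem' := ⟨0, fun _ => P.zero_mem, map_zero _⟩
  add_mem' := by
    rintro _ _ ⟨f, hf, rfl⟩ ⟨g, hg, rfl⟩
    exact ⟨f + g, fun i => add_mem (hf i) (hg i), map_add _ _ _⟩
  smul_mem' := by
    rintro c _ ⟨f, hf, rfl⟩
    exact ⟨c • f, fun i => P.smul_mem c (hf i), map_smul _ _ _⟩

/-! ### Extending a representation to the completion -/

variable {𝒜} {W : Type*} [AddCommGroup W] [Module R W] (ρ : A →ₐ[R] Module.End R W)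

/-- Every vector is killed by all the elements of sufficiently negative degree. -/
def IsLowerTruncated (𝒜 : ℤ → Submodule R A) (ρ : A →ₐ[R] Module.End R W) : Prop :=
  ∀ w : W, ∃ k : ℤ, ∀ n : ℤ, k < n → ∀ a ∈ 𝒜 (-n), ρ a w = 0

variable {ρ}

theorem IsLowerTruncated.exists_nhd (hρ : IsLowerTruncated 𝒜 ρ) (w : W) :
    ∃ k : ℤ, ∀ a ∈ nhd 𝒜 k, ρ a w = 0 := by
  obtain ⟨k, hk⟩ := hρ w
  refine ⟨k, fun a ha => ?_⟩
  have key : nhd 𝒜 k ≤ LinearMap.ker ((LinearMap.applyₗ w).comp ρ.toLinearMap) := by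
    simp only [nhd, sub, iSup_le_iff]
    intro m n hn
    refine Submodule.mul_le.2 fun x _ y hy => ?_
    simp [hk n hn y hy]
  simpa using key ha

theorem IsLowerTruncated.exists_eventually (hρ : IsLowerTruncated 𝒜 ρ) (f : cauchySeq 𝒜) (w : W) :
    ∃ x : W, ∀ᶠ i in atTop, ρ (f.1 i) w = x := by
  obtain ⟨k, hk⟩ := hρ.exists_nhd w
  obtain ⟨r, hr⟩ := f.2.2 k
  refine ⟨ρ (f.1 r) w, eventually_atTop.2 ⟨r, fun i hi => ?_⟩⟩
  have := hk _ (hr i hi r le_rfl)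
  rwa [map_sub, LinearMap.sub_apply, sub_eq_zero] at this

/-- The eventual value of `f_i w`. -/
def limAct (hρ : IsLowerTruncated 𝒜 ρ) (f : cauchySeq 𝒜) (w : W) : W :=
  (hρ.exists_eventually f w).choose

theorem limAct_spec (hρ : IsLowerTruncated 𝒜 ρ) (f : cauchySeq 𝒜) (w : W) :
    ∀ᶠ i in atTop, ρ (f.1 i) w = limAct hρ f w :=
  (hρ.exists_eventually f w).choose_spec

theorem limAct_eq (hρ : IsLowerTruncated 𝒜 ρ) {f : cauchySeq 𝒜} {w x : W}
    (h : ∀ᶠ i in atTop, ρ (f.1 i) w = x) : limAct hρ f w = x := by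
  obtain ⟨i, h1, h2⟩ := ((limAct_spec hρ f w).and h).exists
  exact h1.symm.trans h2

/-- The action of Cauchy sequences on `W`: `f w = lim f_i w`. -/
def seqRep (hρ : IsLowerTruncated 𝒜 ρ) : cauchySeq 𝒜 →ₐ[R] Module.End R W :=
  AlgHom.ofLinearMap
    { toFun := fun f =>
        { toFun := limAct hρ f
          map_add' := fun x y => limAct_eq hρ <| by
            filter_upwards [limAct_spec hρ f x, limAct_spec hρ f y] with i hx hy
            rw [map_add, hx, hy]
          map_smul' := fun c x => limAct_eq hρ <| by
            filter_upwards [limAct_spec hρ f x] with i hx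
            rw [map_smul, hx, RingHom.id_apply] }
      map_add' := fun f g => LinearMap.ext fun w => limAct_eq hρ <| by
        filter_upwards [limAct_spec hρ f w, limAct_spec hρ g w] with i hf hg
        simp [hf, hg]
      map_smul' := fun c f => LinearMap.ext fun w => limAct_eq hρ <| by
        filter_upwards [limAct_spec hρ f w] with i hf
        simp [hf] }
    (LinearMap.ext fun w => limAct_eq hρ <| by simp)
    (fun f g => LinearMap.ext fun w => limAct_eq hρ <| by
      filter_upwards [limAct_spec hρ f (limAct hρ g w), limAct_spec hρ g w] with i hf hg
      simp [hf, hg])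

theorem seqRep_apply (hρ : IsLowerTruncated 𝒜 ρ) (f : cauchySeq 𝒜) (w : W) :
    seqRep hρ f w = limAct hρ f w := rfl

/-- The natural extension of a lower truncated representation of `A` to the completion `Ã`. -/
def completedRep (hρ : IsLowerTruncated 𝒜 ρ) : Completion 𝒜 →ₐ[R] Module.End R W :=
  Ideal.Quotient.liftₐ (nullSeq 𝒜) (seqRep hρ) fun f hf => LinearMap.ext fun w =>
    limAct_eq hρ <| by
      obtain ⟨k, hk⟩ := hρ.exists_nhd w
      obtain ⟨r, hr⟩ := hf k
      exact eventually_atTop.2 ⟨r, fun i hi => hk _ (hr i hi)⟩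

theorem completedRep_mk (hρ : IsLowerTruncated 𝒜 ρ) (f : cauchySeq 𝒜) :
    completedRep hρ (Completion.mk 𝒜 f) = seqRep hρ f := rfl

end Completion

end GradedCompletion

/-! ## Vertex operator algebras and their modules -/

section Axioms

variable {V W : Type*} [AddCommGroup V] [Module ℂ V] [AddCommGroup W] [Module ℂ W]

/-- The Jacobi identity in components: for all `u, v ∈ V`, `l, m, n ∈ ℤ` and `w ∈ W`,
`∑_{i ≥ 0} (-1)^i (l choose i) u_{m+l-i} v_{n+i} w - ∑_{i ≥ 0} (-1)^{l+i} (l choose i) v_{n+l-i}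
u_{m+i} w = ∑_{i ≥ 0} (m choose i) (u_{l+i} v)_{m+n-i} w`. All sums have finite support. -/
def JacobiIdentity (Y : V →ₗ[ℂ] VertexOperator ℂ V) (YW : V →ₗ[ℂ] VertexOperator ℂ W) : Prop :=
  ∀ (u v : V) (l m n : ℤ) (w : W),
    (∑ᶠ i : ℕ, ((-1 : ℂ) ^ i * (Ring.choose l i : ℤ)) •
        ncoeff (YW u) (m + l - i) (ncoeff (YW v) (n + i) w)) -
      (∑ᶠ i : ℕ, ((-1 : ℂ) ^ (l + i) * (Ring.choose l i : ℤ)) •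
        ncoeff (YW v) (n + l - i) (ncoeff (YW u) (m + i) w)) =
    ∑ᶠ i : ℕ, ((Ring.choose m i : ℤ) : ℂ) • ncoeff (YW (ncoeff (Y u) (l + i) v)) (m + n - i) w

/-- The operators `L(n)`, the coefficients of `T = ∑ L(n) z^{-n-2}`, satisfy the Virasoro relations
with central charge `c`. -/
def VirasoroRelations (T : VertexOperator ℂ W) (c : ℂ) : Prop :=
  ∀ m n : ℤ, ncoeff T (m + 1) * ncoeff T (n + 1) - ncoeff T (n + 1) * ncoeff T (m + 1) =
    ((m : ℂ) - n) • ncoeff T (m + n + 1) +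
      if m + n = 0 then (((m : ℂ) ^ 3 - m) / 12 * c) • (1 : Module.End ℂ W) else 0

/-- The `L(0)`-eigenspace of eigenvalue `h`, where `T = ∑ L(n) z^{-n-2}`. -/
def weightSpace (T : VertexOperator ℂ W) (h : ℂ) : Submodule ℂ W :=
  Module.End.eigenspace (ncoeff T 1) h

end Axioms

/-- A vertex operator algebra structure on the complex vector space `V`. The homogeneous subspace
`V_(n)` is the eigenspace of `L(0)` of eigenvalue `n` (so the sum of these subspaces is direct),
`L(n) = ω_{n+1}`, and `ncoeff (Y u) n` is `u_n`, i.e. `Y(u, z) = ∑ u_n z^{-n-1}`; that `u_n v = 0`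
for large `n` is part of Mathlib's `VertexOperator`. -/
structure VertexOperatorAlgebra (V : Type*) [AddCommGroup V] [Module ℂ V] where
  /-- the vertex operator map -/
  Y : V →ₗ[ℂ] VertexOperator ℂ V
  /-- the vacuum vector -/
  vac : V
  /-- the conformal vector -/
  omega : V
  /-- the central charge -/
  rank : ℂ
  vac_mode : ∀ n : ℤ, ncoeff (Y vac) n = if n = -1 then 1 else 0
  mode_vac : ∀ (u : V) (n : ℤ), 0 ≤ n → ncoeff (Y u) n vac = 0
  creation : ∀ u : V, ncoeff (Y u) (-1) vac = u
  jacobi : JacobiIdentity Y Y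
  virasoro : VirasoroRelations (Y omega) rank
  derivative : ∀ (u : V) (n : ℤ),
    ncoeff (Y (ncoeff (Y omega) 0 u)) n = -(n : ℂ) • ncoeff (Y u) (n - 1)
  iSup_weight : ⨆ n : ℤ, weightSpace (Y omega) n = ⊤
  finite_weight : ∀ n : ℤ, FiniteDimensional ℂ (weightSpace (Y omega) n)
  truncated : ∃ N : ℤ, ∀ n : ℤ, n < N → weightSpace (Y omega) n = ⊥

/-- A module for a vertex operator algebra: `W = ⨁_{h ∈ ℂ} W_(h)`, where `W_(h)` is the
`L(0)`-eigenspace, with all `W_(h)` finite-dimensional and `W_(h+n) = 0` for `n` small. -/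
structure VOAModule {V : Type*} [AddCommGroup V] [Module ℂ V] (𝓥 : VertexOperatorAlgebra V)
    (W : Type*) [AddCommGroup W] [Module ℂ W] where
  /-- the vertex operator map of the module -/
  Y : V →ₗ[ℂ] VertexOperator ℂ W
  vac_mode : ∀ n : ℤ, ncoeff (Y 𝓥.vac) n = if n = -1 then 1 else 0
  jacobi : JacobiIdentity 𝓥.Y Y
  virasoro : VirasoroRelations (Y 𝓥.omega) 𝓥.rank
  derivative : ∀ (u : V) (n : ℤ),
    ncoeff (Y (ncoeff (𝓥.Y 𝓥.omega) 0 u)) n = -(n : ℂ) • ncoeff (Y u) (n - 1)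
  iSup_weight : ⨆ h : ℂ, weightSpace (Y 𝓥.omega) h = ⊤
  finite_weight : ∀ h : ℂ, FiniteDimensional ℂ (weightSpace (Y 𝓥.omega) h)
  truncated : ∀ h : ℂ, ∃ N : ℤ, ∀ n : ℤ, n < N → weightSpace (Y 𝓥.omega) (h + n) = ⊥

section TruncationLemma

variable {W : Type*} [AddCommGroup W] [Module ℂ W]

theorem ncoeff_eventually_zero (T : VertexOperator ℂ W) (w : W) :
    ∃ N : ℤ, ∀ n : ℤ, N ≤ n → ncoeff T n w = 0 :=
  ⟨-HahnSeries.order ((HahnModule.of ℂ).symm (T w)), fun n hn =>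
    VertexOperator.ncoeff_eq_zero_of_lt_order T n w (by lia)⟩

end TruncationLemma

/-! ## The universal enveloping algebra `U(V)` -/

namespace VertexOperatorAlgebra

open GradedCompletion

section Enveloping

variable {V : Type*} [AddCommGroup V] [Module ℂ V] (𝓥 : VertexOperatorAlgebra V)

/-- The homogeneous subspace `V_(n)`. -/
def weight (n : ℤ) : Submodule ℂ V := weightSpace (𝓥.Y 𝓥.omega) n

/-- The free associative algebra with unit on `V̂ = V ⊗ ℂ[t, t⁻¹]`. -/
abbrev FreeAlg (V : Type*) [AddCommGroup V] [Module ℂ V] : Type _ :=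
  TensorAlgebra ℂ (V ⊗[ℂ] ℂ[T;T⁻¹])

/-- The generator `v(n) = v ⊗ tⁿ`. -/
def gen (v : V) (n : ℤ) : FreeAlg V :=
  TensorAlgebra.ι ℂ (v ⊗ₜ[ℂ] (LaurentPolynomial.T n : ℂ[T;T⁻¹]))

/-- Products of generators `v(n)` with `v` homogeneous, where `v(n)` has degree `wt v - n - 1`. -/
inductive IsMonomial : ℤ → FreeAlg V → Prop
  | one : IsMonomial 0 1
  | cons {p n d : ℤ} {v : V} {a : FreeAlg V} (hv : v ∈ 𝓥.weight p) (ha : IsMonomial d a) :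
      IsMonomial ((p - n - 1) + d) (gen v n * a)

/-- The homogeneous subspace `A_m` of the free algebra `A`. -/
def deg (m : ℤ) : Submodule ℂ (FreeAlg V) := Submodule.span ℂ {a | 𝓥.IsMonomial m a}

variable {𝓥}

theorem IsMonomial.mul {m n : ℤ} {a b : FreeAlg V} (ha : 𝓥.IsMonomial m a)
    (hb : 𝓥.IsMonomial n b) : 𝓥.IsMonomial (m + n) (a * b) := by
  induction ha with
  | one => simpa using hb
  | cons hv _ ih =>
    rw [mul_assoc, add_assoc]
    exact IsMonomial.cons hv ih

theorem gen_mem_deg {p : ℤ} {v : V} (hv : v ∈ 𝓥.weight p) (n : ℤ) :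
    gen v n ∈ 𝓥.deg (p - n - 1) := by
  refine Submodule.subset_span ?_
  simpa using IsMonomial.cons (n := n) hv IsMonomial.one

theorem gen_add (u v : V) (n : ℤ) : gen (u + v) n = gen u n + gen v n := by
  simp [gen, TensorProduct.add_tmul]

theorem gen_zero (n : ℤ) : gen (0 : V) n = 0 := by
  simp [gen]

variable (𝓥)

instance : SetLike.GradedMonoid 𝓥.deg where
  one_mem := Submodule.subset_span IsMonomial.one
  mul_mem m n a b ha hb := by
    have h : 𝓥.deg m * 𝓥.deg n ≤ 𝓥.deg (m + n) := by
      rw [deg, deg, Submodule.span_mul_span, Submodule.span_le]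
      rintro _ ⟨x, hx, y, hy, rfl⟩
      exact Submodule.subset_span (IsMonomial.mul hx hy)
    exact h (Submodule.mul_mem_mul ha hb)

theorem weight_induction {P : V → Prop} (hom : ∀ p, ∀ v ∈ 𝓥.weight p, P v) (zero : P 0)
    (add : ∀ u v, P u → P v → P (u + v)) (v : V) : P v :=
  Submodule.iSup_induction (fun n : ℤ => weightSpace (𝓥.Y 𝓥.omega) n) (motive := P)
    (by rw [𝓥.iSup_weight]; trivial) hom zero add

/-- The completion `Ã` of the free algebra. -/
abbrev CompletedAlg : Type _ := Completion 𝓥.deg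

theorem isCauchySeq_gen (v : V) (n : ℤ) : (fun _ => gen v n) ∈ cauchySeq 𝓥.deg := by
  induction v using 𝓥.weight_induction with
  | hom p v hv => exact isCauchySeq_const (gen_mem_deg hv n)
  | zero => simp only [gen_zero]; exact zero_mem (cauchySeq 𝓥.deg)
  | add u v hu hv => simp only [gen_add]; exact add_mem hu hv

/-- The image of `v(n)` in `Ã`. -/
def cgen (v : V) (n : ℤ) : 𝓥.CompletedAlg := Completion.mk 𝓥.deg ⟨_, 𝓥.isCauchySeq_gen v n⟩

/-- The partial sums of `∑_{i ≥ 0} c_i u(a-i) v(b+i)`. -/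
def quadSeq (c : ℕ → ℂ) (u v : V) (a b : ℤ) (N : ℕ) : FreeAlg V :=
  ∑ i ∈ Finset.range N, c i • (gen u (a - i) * gen v (b + i))

theorem isCauchySeq_quadSeq (c : ℕ → ℂ) (u v : V) (a b : ℤ) :
    quadSeq c u v a b ∈ cauchySeq 𝓥.deg := by
  induction u using 𝓥.weight_induction with
  | zero =>
    have : quadSeq c 0 v a b = 0 := by ext; simp [quadSeq, gen_zero]
    rw [this]; exact zero_mem _
  | add u u' hu hu' =>
    have : quadSeq c (u + u') v a b = quadSeq c u v a b + quadSeq c u' v a b := by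
      ext; simp [quadSeq, gen_add, add_mul, Finset.sum_add_distrib]
    rw [this]; exact add_mem hu hu'
  | hom p u hu =>
  induction v using 𝓥.weight_induction with
  | zero =>
    have : quadSeq c u 0 a b = 0 := by ext; simp [quadSeq, gen_zero]
    rw [this]; exact zero_mem _
  | add v v' hv hv' =>
    have : quadSeq c u (v + v') a b = quadSeq c u v a b + quadSeq c u v' a b := by
      ext; simp [quadSeq, gen_add, mul_add, Finset.sum_add_distrib]
    rw [this]; exact add_mem hv hv'
  | hom q v hv =>
  refine ⟨⟨(p + q - a - b - 2).natAbs, fun N => le_bdd _ (Submodule.sum_mem _ fun i _ =>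
    Submodule.smul_mem _ _ ?_)⟩, fun k => ?_⟩
  · have h := SetLike.mul_mem_graded (gen_mem_deg hu (a - i)) (gen_mem_deg hv (b + i))
    have e : p - (a - i) - 1 + (q - (b + i) - 1) = p + q - a - b - 2 := by ring
    rwa [e] at h
  · have key : ∀ N, (q + k - b).toNat ≤ N →
        quadSeq c u v a b N - quadSeq c u v a b (q + k - b).toNat ∈ nhd 𝓥.deg k := by
      intro N hN
      rw [quadSeq, quadSeq, Finset.sum_range_sub_sum_range hN]
      refine Submodule.sum_mem _ fun i hi => Submodule.smul_mem _ _ ?_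
      rw [Finset.mem_filter] at hi
      exact mul_le_nhd (by lia) (Submodule.mul_mem_mul (gen_mem_deg hu _) (gen_mem_deg hv _))
    refine ⟨(q + k - b).toNat, fun i hi j hj => ?_⟩
    simpa using sub_mem (key i hi) (key j hj)

/-- The element `∑_{i ≥ 0} c_i u(a-i) v(b+i)` of `Ã`. -/
def quadSum (c : ℕ → ℂ) (u v : V) (a b : ℤ) : 𝓥.CompletedAlg :=
  Completion.mk 𝓥.deg ⟨_, 𝓥.isCauchySeq_quadSeq c u v a b⟩

/-- The defining relations of `U(V)`: `1(n) = δ_{n,-1}`, `(L(-1)u)(n) = -n u(n-1)`, and the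
Jacobi identity. -/
inductive JacRel : 𝓥.CompletedAlg → 𝓥.CompletedAlg → Prop
  | vac (n : ℤ) : JacRel (𝓥.cgen 𝓥.vac n) (if n = -1 then 1 else 0)
  | derivative (u : V) (n : ℤ) :
      JacRel (𝓥.cgen (ncoeff (𝓥.Y 𝓥.omega) 0 u) n) (-(n : ℂ) • 𝓥.cgen u (n - 1))
  | jacobi (u v : V) (l m n : ℤ) :
      JacRel
        (𝓥.quadSum (fun i => (-1 : ℂ) ^ i * (Ring.choose l i : ℤ)) u v (m + l) n -
          𝓥.quadSum (fun i => (-1 : ℂ) ^ (l + i) * (Ring.choose l i : ℤ)) v u (n + l) m)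
        (∑ᶠ i : ℕ, ((Ring.choose m i : ℤ) : ℂ) • 𝓥.cgen (ncoeff (𝓥.Y u) (l + i) v) (m + n - i))

/-- The universal enveloping algebra `U(V)`: the quotient of `Ã` by the two-sided ideal `Jac`
generated by the defining relations. -/
abbrev Enveloping : Type _ := RingQuot 𝓥.JacRel

/-- The homogeneous subspace `U(V)_n`, the image of `Ã_n`. -/
def envDeg (n : ℤ) : Submodule ℂ 𝓥.Enveloping :=
  (Completion.ofSub 𝓥.deg (𝓥.deg n)).map (RingQuot.mkAlgHom ℂ 𝓥.JacRel).toLinearMap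

/-- The basic neighbourhoods of `0` in `U(V)_n`: the images of the closures in `Ã_n` of the
subspaces `A_{n,k}`. -/
def envNhd (n k : ℤ) : Submodule ℂ 𝓥.Enveloping :=
  (Completion.ofSub 𝓥.deg (sub 𝓥.deg n k)).map (RingQuot.mkAlgHom ℂ 𝓥.JacRel).toLinearMap

end Enveloping

end VertexOperatorAlgebra

/-! ## The action of `U(V)` on a module -/

namespace VOAModule

open GradedCompletion VertexOperatorAlgebra

section Action

variable {V : Type*} [AddCommGroup V] [Module ℂ V] {𝓥 : VertexOperatorAlgebra V}
  {W : Type*} [AddCommGroup W] [Module ℂ W] (M : VOAModule 𝓥 W)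

/-- The homogeneous subspace `W_(h)`. -/
def weight (h : ℂ) : Submodule ℂ W := weightSpace (M.Y 𝓥.omega) h

/-- `M` is irreducible: `W ≠ 0`, and `0` and `W` are the only submodules. -/
def IsIrreducible : Prop :=
  Nontrivial W ∧ ∀ N : Submodule ℂ W,
    (∀ (u : V) (n : ℤ), ∀ w ∈ N, ncoeff (M.Y u) n w ∈ N) → N = ⊥ ∨ N = ⊤

/-- `M` and `M'` are equivalent, i.e. isomorphic. -/
def IsEquivalent {W' : Type*} [AddCommGroup W'] [Module ℂ W'] (M' : VOAModule 𝓥 W') : Prop :=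
  ∃ e : W ≃ₗ[ℂ] W', ∀ (u : V) (n : ℤ) (w : W), e (ncoeff (M.Y u) n w) = ncoeff (M'.Y u) n (e w)

/-- The linear map `V ⊗ ℂ[t, t⁻¹] → End W` with `u ⊗ tⁿ ↦ u_n`. -/
def modeMap : V ⊗[ℂ] ℂ[T;T⁻¹] →ₗ[ℂ] Module.End ℂ W :=
  TensorProduct.lift <| LinearMap.mk₂ ℂ
    (fun u p => Finsupp.linearCombination ℂ (fun n : ℤ => ncoeff (M.Y u) n) p.coeff)
    (fun u v p => by simp [Finsupp.linearCombination_apply, Finsupp.sum, Finset.sum_add_distrib])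
    (fun c u p => by
      simp [Finsupp.linearCombination_apply, Finsupp.sum, Finset.smul_sum, smul_comm c])
    (fun u p q => by rw [AddMonoidAlgebra.coeff_add, map_add])
    (fun c u p => by rw [AddMonoidAlgebra.coeff_smul, map_smul])

/-- The representation of the free algebra with `u(n) ↦ u_n`. -/
def freeRep : FreeAlg V →ₐ[ℂ] Module.End ℂ W := TensorAlgebra.lift ℂ M.modeMap

theorem freeRep_gen (u : V) (n : ℤ) : M.freeRep (gen u n) = ncoeff (M.Y u) n := by
  rw [freeRep, gen, TensorAlgebra.lift_ι_apply, modeMap, TensorProduct.lift.tmul,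
    LinearMap.mk₂_apply, LaurentPolynomial.T, AddMonoidAlgebra.coeff_single,
    Finsupp.linearCombination_single, one_smul]

theorem mode_mem_weight {p : ℤ} {u : V} (hu : u ∈ 𝓥.weight p) (n : ℤ) {h : ℂ} {w : W}
    (hw : w ∈ M.weight h) : ncoeff (M.Y u) n w ∈ M.weight (h + (p - n - 1 : ℤ)) := by
  have hu' : ncoeff (𝓥.Y 𝓥.omega) 1 u = (p : ℂ) • u := Module.End.mem_eigenspace_iff.1 hu
  have hw' : ncoeff (M.Y 𝓥.omega) 1 w = h • w := Module.End.mem_eigenspace_iff.1 hw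
  refine Module.End.mem_eigenspace_iff.2 ?_
  have J := M.jacobi 𝓥.omega u 0 1 n w
  have h0 : ∀ i : ℕ, i ≠ 0 → Ring.choose (0 : ℤ) i = 0 := fun i hi => by
    rw [Ring.choose_zero_ite, if_neg hi]
  rw [finsum_eq_single _ 0 (fun i hi => by simp [h0 i hi]),
    finsum_eq_single _ 0 (fun i hi => by simp [h0 i hi]),
    finsum_eq_sum_of_support_subset (s := Finset.range 2)] at J
  · simp only [Finset.sum_range_succ, Finset.range_zero, Finset.sum_empty] at J
    simp only [Ring.choose_zero_right, Ring.choose_one_right, Nat.cast_zero, Nat.cast_one,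
      add_zero, zero_add, sub_zero, zpow_zero, pow_zero, mul_one, one_smul, Int.cast_one, hw',
      hu', M.derivative, map_smul, LinearMap.smul_apply, add_sub_cancel_left,
      Pi.smul_apply] at J
    rw [sub_eq_iff_eq_add] at J
    rw [J, ← add_smul, ← add_smul]
    congr 1
    push_cast
    ring
  · intro i hi
    by_contra hi'
    refine hi ?_
    have : Ring.choose (1 : ℤ) i = 0 := by
      have h1 : Ring.choose ((1 : ℕ) : ℤ) i = (Nat.choose 1 i : ℤ) := Ring.choose_natCast 1 i
      rw [Nat.cast_one] at h1
      rw [h1, Nat.choose_eq_zero_of_lt (by simpa using hi'), Nat.cast_zero]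
    simp [this]

theorem deg_mem_weight {m : ℤ} {a : FreeAlg V} (ha : a ∈ 𝓥.deg m) {h : ℂ} {w : W}
    (hw : w ∈ M.weight h) : M.freeRep a w ∈ M.weight (h + m) := by
  induction ha using Submodule.span_induction with
  | zero => simp
  | add x y _ _ hx hy => rw [map_add]; exact add_mem hx hy
  | smul c x _ hx => rw [map_smul]; exact Submodule.smul_mem _ _ hx
  | mem a ha =>
    induction ha with
    | one => simpa using hw
    | @cons p n d v a hv _ ih =>
      rw [map_mul, freeRep_gen]
      have e : h + ((p - n - 1 + d : ℤ) : ℂ) = h + d + (p - n - 1 : ℤ) := by push_cast; ring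
      rw [e]
      exact M.mode_mem_weight hv n ih

theorem isLowerTruncated : IsLowerTruncated 𝓥.deg M.freeRep := fun w =>
  Submodule.iSup_induction (fun h : ℂ => weightSpace (M.Y 𝓥.omega) h)
    (motive := fun w => ∃ k : ℤ, ∀ n : ℤ, k < n → ∀ a ∈ 𝓥.deg (-n), M.freeRep a w = 0)
    (by rw [M.iSup_weight]; trivial)
    (fun h w hw => by
      obtain ⟨N, hN⟩ := M.truncated h
      refine ⟨-N, fun n hn a ha => ?_⟩
      have h1 := M.deg_mem_weight ha hw
      rwa [weight, hN (-n) (by lia), Submodule.mem_bot] at h1)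
    ⟨0, fun _ _ _ _ => map_zero _⟩
    (fun x y ⟨k, hk⟩ ⟨l, hl⟩ => ⟨max k l, fun n hn a ha => by
      rw [map_add, hk n (lt_of_le_of_lt (le_max_left _ _) hn) a ha,
        hl n (lt_of_le_of_lt (le_max_right _ _) hn) a ha, add_zero]⟩)

/-- The representation of `Ã` on `W`. -/
def complRep : 𝓥.CompletedAlg →ₐ[ℂ] Module.End ℂ W := completedRep M.isLowerTruncated

theorem complRep_cgen (u : V) (n : ℤ) : M.complRep (𝓥.cgen u n) = ncoeff (M.Y u) n :=
  LinearMap.ext fun w => limAct_eq M.isLowerTruncated <| .of_forall fun _ => by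
    simp [freeRep_gen]

theorem complRep_quadSum (c : ℕ → ℂ) (u v : V) (a b : ℤ) (w : W) :
    M.complRep (𝓥.quadSum c u v a b) w =
      ∑ᶠ i : ℕ, c i • ncoeff (M.Y u) (a - i) (ncoeff (M.Y v) (b + i) w) := by
  refine limAct_eq M.isLowerTruncated ?_
  obtain ⟨N, hN⟩ := ncoeff_eventually_zero (M.Y v) w
  refine eventually_atTop.2 ⟨(N - b).toNat, fun r hr => ?_⟩
  rw [finsum_eq_sum_of_support_subset (s := Finset.range r)]
  · simp [quadSeq, freeRep_gen]
  · intro i hi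
    by_contra hi'
    refine hi ?_
    have : (r : ℤ) ≤ i := by simpa using hi'
    have h0 : ncoeff (M.Y v) (b + i) w = 0 := hN _ (by lia)
    simp [h0]

theorem complRep_rel {x y : 𝓥.CompletedAlg} (h : 𝓥.JacRel x y) :
    M.complRep x = M.complRep y := by
  cases h with
  | vac n =>
    rw [complRep_cgen, M.vac_mode]
    split_ifs <;> simp
  | derivative u n => rw [map_smul, complRep_cgen, complRep_cgen, M.derivative]
  | jacobi u v l m n =>
    refine LinearMap.ext fun w => ?_
    rw [map_sub, LinearMap.sub_apply, complRep_quadSum, complRep_quadSum, M.jacobi]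
    obtain ⟨N, hN⟩ := ncoeff_eventually_zero (𝓥.Y u) v
    have hz : ∀ i : ℕ, i ∉ Finset.range (N - l).toNat → ncoeff (𝓥.Y u) (l + i) v = 0 := by
      intro i hi
      have : (N - l).toNat ≤ i := by simpa using hi
      exact hN _ (by lia)
    rw [finsum_eq_sum_of_support_subset (s := Finset.range (N - l).toNat),
      finsum_eq_sum_of_support_subset (s := Finset.range (N - l).toNat)]
    · simp [complRep_cgen]
    · intro i hi
      by_contra hi'
      refine hi ?_
      have hc : 𝓥.cgen 0 (m + n - i) = 0 := by
        have h0 : (⟨_, 𝓥.isCauchySeq_gen 0 (m + n - i)⟩ : cauchySeq 𝓥.deg) = 0 :=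
          Subtype.ext (funext fun _ => gen_zero _)
        rw [cgen, h0, map_zero]
      simp only [hz i hi', hc, smul_zero]
    · intro i hi
      by_contra hi'
      refine hi ?_
      simp [hz i hi']

/-- The representation of `U(V)` on the module `W`: the continuous representation with
`u(n) ↦ u_n`. -/
def rep : 𝓥.Enveloping →ₐ[ℂ] Module.End ℂ W :=
  RingQuot.liftAlgHom ℂ ⟨M.complRep, fun _ _ h => M.complRep_rel h⟩

/-- The annihilator of `W` in `U(V)`. -/
def annihilator : Ideal 𝓥.Enveloping := RingHom.ker M.rep

instance : M.annihilator.IsTwoSided := inferInstanceAs (RingHom.ker M.rep).IsTwoSided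

theorem rep_mk (x : 𝓥.CompletedAlg) : M.rep (RingQuot.mkAlgHom ℂ 𝓥.JacRel x) = M.complRep x :=
  RingQuot.liftAlgHom_mkAlgHom_apply ℂ _ _ _

end Action

end VOAModule

/-! ## The algebra `gl_J(W)` -/

section GLJ

variable {ι : Type*} [AddCommGroupWithOne ι] {W : Type*} [AddCommGroup W] [Module ℂ W]
  (𝒲 : ι → Submodule ℂ W)

/-- The endomorphisms of `W = ⨁ W(h)` that are homogeneous of degree `k ∈ ℤ`, i.e. that map each
`W(h)` into `W(h + k)`. -/
def glJDeg (k : ℤ) : Submodule ℂ (Module.End ℂ W) where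
  carrier := {f | ∀ h : ι, ∀ w ∈ 𝒲 h, f w ∈ 𝒲 (h + k)}
  zero_mem' h _ _ := (𝒲 (h + k)).zero_mem
  add_mem' hf hg h w hw := add_mem (hf h w hw) (hg h w hw)
  smul_mem' c _ hf h w hw := Submodule.smul_mem _ c (hf h w hw)

theorem mul_mem_glJDeg {k l : ℤ} {f g : Module.End ℂ W} (hf : f ∈ glJDeg 𝒲 k)
    (hg : g ∈ glJDeg 𝒲 l) : f * g ∈ glJDeg 𝒲 (k + l) := fun h w hw => by
  have h1 := hf _ _ (hg h w hw)
  rwa [add_assoc, ← Int.cast_add, add_comm l k] at h1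

/-- `gl_J(W)`, the sum of the spaces of homogeneous endomorphisms of degree `k`, `k ∈ ℤ`. -/
def glJ : Subalgebra ℂ (Module.End ℂ W) where
  carrier := {f | f ∈ ⨆ k : ℤ, glJDeg 𝒲 k}
  mul_mem' {f g} hf hg := by
    have h : (⨆ k : ℤ, glJDeg 𝒲 k) * (⨆ k : ℤ, glJDeg 𝒲 k) ≤ ⨆ k : ℤ, glJDeg 𝒲 k := by
      rw [Submodule.iSup_mul]
      refine iSup_le fun k => ?_
      rw [Submodule.mul_iSup]
      refine iSup_le fun l => Submodule.mul_le.2 fun a ha b hb => ?_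
      exact Submodule.mem_iSup_of_mem (k + l) (mul_mem_glJDeg 𝒲 ha hb)
    exact h (Submodule.mul_mem_mul hf hg)
  add_mem' {f g} hf hg := (⨆ k : ℤ, glJDeg 𝒲 k).add_mem hf hg
  algebraMap_mem' c := Submodule.mem_iSup_of_mem 0 fun h w hw => by
    simpa using Submodule.smul_mem _ c hw

/-- The basic neighbourhoods of `0` in the space of homogeneous endomorphisms of degree `k`, which
is `∏_h Hom(W(h), W(h + k))` with the product of the discrete topologies: those endomorphisms that
vanish on `W(h)` for the finitely many `h` in `S`. -/
def glJNhd (k : ℤ) (S : Finset ι) : Submodule ℂ (Module.End ℂ W) where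
  carrier := {f | f ∈ glJDeg 𝒲 k ∧ ∀ h ∈ S, ∀ w ∈ 𝒲 h, f w = 0}
  zero_mem' := ⟨zero_mem _, fun _ _ _ _ => rfl⟩
  add_mem' hf hg := ⟨add_mem hf.1 hg.1, fun h hh w hw => by
    simp [hf.2 h hh w hw, hg.2 h hh w hw]⟩
  smul_mem' c _ hf := ⟨Submodule.smul_mem _ c hf.1, fun h hh w hw => by
    simp [hf.2 h hh w hw]⟩

end GLJ

/-- If the weights of `W` lie in `h₀ + ℤ`, then the homogeneous endomorphisms for the grading by
weights are those for the shifted `ℤ`-grading `W(n) = W_(h₀ + n)`. -/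
theorem glJDeg_shift {W : Type*} [AddCommGroup W] [Module ℂ W] (𝒲 : ℂ → Submodule ℂ W) (h₀ : ℂ)
    (hsupp : ∀ h, 𝒲 h ≠ ⊥ → ∃ n : ℤ, h = h₀ + n) (k : ℤ) :
    glJDeg 𝒲 k = glJDeg (fun n : ℤ => 𝒲 (h₀ + n)) k := by
  ext f
  constructor
  · intro hf n w hw
    have h1 := hf _ w hw
    rwa [add_assoc, ← Int.cast_add] at h1
  · intro hf h w hw
    by_cases hb : 𝒲 h = ⊥
    · rw [hb, Submodule.mem_bot] at hw
      simp [hw]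
    · obtain ⟨n, rfl⟩ := hsupp h hb
      have h1 := hf n w hw
      rw [add_assoc, ← Int.cast_add]
      exact h1

end

/-!
The isomorphism comes from a graded form of the Jacobson density theorem.

`U(V)` acts on the product of the `W_i` through the lower truncated action of the free algebra `A`.
Each `W_i` is a simple `A`-module, and by Schur's lemma (`VOAModule.IsIrreducible.exists_eq_smul`)
the commutant of `A` on `∏ W_i` consists of families of scalars. Density then yields, for any family
of endomorphisms, one element of `A` with prescribed values on finitely many vectors
(`VOAModule.exists_freeRep_eq`). Comparing weights, a family of degree `d` is realized on finitely
many weight spaces by an element of `A_d` (`VOAModule.exists_deg_freeRep_eq`).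

The weights of `W_i` lie in `h_i + ℕ` for a lowest weight `h_i`; call `W_(h_i + s)` the level `s`.
A rank one operator of degree `n` supported on the level `t` factors through a lowest weight vector,
so on the levels up to `t` it is realized by an element of `A_{n+t} A_{-t}`, which is contained in
`A_{n,k}` whenever `k < t` (`VOAModule.exists_mem_sub_rank_one`). Hence a family of degree `n` that
vanishes on the levels `0, …, k` can be corrected level by level by elements of `A_{n,k}`,
`A_{n,k+1}`, …, and is the limit of a Cauchy sequence in `A_{n,k}`
(`VOAModule.exists_cauchySeq_seqRep_eq`). This is openness in degree `n`; as no levels are negative,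
`k = -1` gives surjectivity in degree `n`. Conversely, a Cauchy sequence lies in finitely many
degrees, so its limit is a sum of homogeneous endomorphisms
(`VOAModule.complRep_mem_glJ`), and truncation gives continuity.
-/

namespace VertexOperatorAlgebra

open GradedCompletion

variable {V : Type*} [AddCommGroup V] [Module ℂ V] (𝓥 : VertexOperatorAlgebra V)

/-! ### Generators and grading of the free algebra -/

theorem adjoin_gen :
    Algebra.adjoin ℂ {a : FreeAlg V | ∃ v n, gen v n = a} = ⊤ := by
  rw [eq_top_iff, ← TensorAlgebra.adjoin_range_ι]
  refine Algebra.adjoin_le ?_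
  rintro _ ⟨x, rfl⟩
  induction x with
  | zero => rw [map_zero]; exact zero_mem _
  | add x y hx hy => rw [map_add]; exact add_mem hx hy
  | tmul v p =>
    induction p using LaurentPolynomial.induction_on' with
    | add p q hp hq => rw [TensorProduct.tmul_add, map_add]; exact add_mem hp hq
    | C_mul_T n c =>
      rw [← LaurentPolynomial.smul_eq_C_mul, TensorProduct.tmul_smul, map_smul]
      exact Subalgebra.smul_mem _ (Algebra.subset_adjoin (Set.mem_ofPred.2 ⟨v, n, rfl⟩)) c

theorem iSup_deg : ⨆ m : ℤ, 𝓥.deg m = ⊤ := by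
  refine eq_top_iff.2 fun a _ => ?_
  have ha : a ∈ Algebra.adjoin ℂ {a : FreeAlg V | ∃ v n, gen v n = a} := by
    rw [adjoin_gen]; trivial
  induction ha using Algebra.adjoin_induction with
  | mem a ha =>
    obtain ⟨v, n, rfl⟩ := ha
    induction v using 𝓥.weight_induction with
    | hom p v hv => exact Submodule.mem_iSup_of_mem _ (gen_mem_deg hv n)
    | zero => rw [gen_zero]; exact zero_mem _
    | add u v hu hv => rw [gen_add]; exact add_mem (hu trivial) (hv trivial)
  | algebraMap c =>
    rw [Algebra.algebraMap_eq_smul_one]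
    exact Submodule.smul_mem _ _ (Submodule.mem_iSup_of_mem 0 SetLike.GradedOne.one_mem)
  | add a b _ _ ha hb => exact add_mem (ha trivial) (hb trivial)
  | mul a b _ _ ha hb =>
    have h : (⨆ k : ℤ, 𝓥.deg k) * (⨆ k : ℤ, 𝓥.deg k) ≤ ⨆ k : ℤ, 𝓥.deg k := by
      rw [Submodule.iSup_mul]
      refine iSup_le fun k => ?_
      rw [Submodule.mul_iSup]
      exact iSup_le fun l => (deg_mul_le k l).trans (le_iSup 𝓥.deg (k + l))
    exact h (Submodule.mul_mem_mul (ha trivial) (hb trivial))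

theorem exists_eq_sum_deg (a : FreeAlg V) :
    ∃ (s : Finset ℤ) (f : ℤ → FreeAlg V), (∀ m, f m ∈ 𝓥.deg m) ∧ a = ∑ m ∈ s, f m := by
  have ha : a ∈ ⨆ m : ℤ, 𝓥.deg m := by rw [iSup_deg]; trivial
  obtain ⟨f, hf, rfl⟩ := (Submodule.mem_iSup_iff_exists_finsupp _ _).1 ha
  exact ⟨f.support, f, hf, rfl⟩

theorem sub_le_deg (m k : ℤ) : sub 𝓥.deg m k ≤ 𝓥.deg m :=
  iSup₂_le fun n _ => (deg_mul_le (m + n) (-n)).trans (by rw [add_neg_cancel_right])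

end VertexOperatorAlgebra

namespace VOAModule

open GradedCompletion VertexOperatorAlgebra

variable {V : Type*} [AddCommGroup V] [Module ℂ V] {𝓥 : VertexOperatorAlgebra V}

section WeightDecomposition

variable {W : Type*} [AddCommGroup W] [Module ℂ W] (M : VOAModule 𝓥 W)

/-! ### The weight decomposition of a module -/

theorem iSupIndep_weight : iSupIndep M.weight :=
  Module.End.eigenspaces_iSupIndep (ncoeff (M.Y 𝓥.omega) 1)

theorem iSup_weight_eq_top : ⨆ h, M.weight h = ⊤ := M.iSup_weight

theorem weight_induction {P : W → Prop} (hom : ∀ h, ∀ w ∈ M.weight h, P w) (zero : P 0)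
    (add : ∀ u v, P u → P v → P (u + v)) (w : W) : P w :=
  Submodule.iSup_induction M.weight (motive := P)
    (by rw [M.iSup_weight_eq_top]; trivial) hom zero add

variable {M} in
theorem end_ext {f g : Module.End ℂ W} (H : ∀ h, ∀ w ∈ M.weight h, f w = g w) : f = g := by
  ext w
  induction w using M.weight_induction with
  | hom h w hw => exact H h w hw
  | zero => simp
  | add u v hu hv => rw [map_add, map_add, hu, hv]

/-- A linear map out of `W = ⨁ W_(h)` may be prescribed arbitrarily on each `W_(h)`. -/
theorem exists_extend (f : ∀ h, M.weight h →ₗ[ℂ] W) :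
    ∃ F : Module.End ℂ W, ∀ h (w : M.weight h), F w = f h w := by
  classical
  have hI : DirectSum.IsInternal M.weight :=
    (DirectSum.isInternal_submodule_iff_iSupIndep_and_iSup_eq_top _).2
      ⟨M.iSupIndep_weight, M.iSup_weight_eq_top⟩
  let E := LinearEquiv.ofBijective (DirectSum.coeLinearMap M.weight) hI
  refine ⟨(DirectSum.toModule ℂ ℂ W f).comp E.symm.toLinearMap, fun h w => ?_⟩
  have : E.symm w = DirectSum.lof ℂ ℂ (fun h => M.weight h) h w := by
    rw [LinearEquiv.symm_apply_eq]
    exact (DirectSum.coeLinearMap_lof M.weight h w).symm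
  simp [this]

theorem exists_proj (h : ℂ) : ∃ F : Module.End ℂ W, (∀ w ∈ M.weight h, F w = w) ∧
    ∀ h', h' ≠ h → ∀ w ∈ M.weight h', F w = 0 := by
  classical
  obtain ⟨F, hF⟩ := M.exists_extend fun h' => if h' = h then (M.weight h').subtype else 0
  refine ⟨F, fun w hw => ?_, fun h' hh w hw => ?_⟩
  · simpa using hF h ⟨w, hw⟩
  · simpa [hh] using hF h' ⟨w, hw⟩

/-- The projection of `W` onto `W_(h)` along the other weight spaces. -/
noncomputable def proj (h : ℂ) : Module.End ℂ W := (M.exists_proj h).choose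

variable {M}

theorem proj_of_mem {h : ℂ} {w : W} (hw : w ∈ M.weight h) : M.proj h w = w :=
  (M.exists_proj h).choose_spec.1 w hw

theorem proj_of_ne {h h' : ℂ} (hh : h' ≠ h) {w : W} (hw : w ∈ M.weight h') : M.proj h w = 0 :=
  (M.exists_proj h).choose_spec.2 h' hh w hw

variable (M) in
theorem proj_mem (h : ℂ) (w : W) : M.proj h w ∈ M.weight h := by
  induction w using M.weight_induction with
  | hom h' w hw =>
    by_cases hh : h' = h
    · subst hh; rwa [proj_of_mem hw]
    · rw [proj_of_ne hh hw]; exact zero_mem _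
  | zero => rw [map_zero]; exact zero_mem _
  | add u v hu hv => rw [map_add]; exact add_mem hu hv

/-- An endomorphism that changes weights by integers of absolute value at most `N` is a sum of
homogeneous ones. -/
theorem mem_glJ_of_bounded {f : Module.End ℂ W} {N : ℕ}
    (hf : ∀ h, ∀ w ∈ M.weight h, f w ∈ ⨆ m : ℤ, ⨆ _ : |m| ≤ (N : ℤ), M.weight (h + m)) :
    f ∈ glJ M.weight := by
  choose F hF using fun m : ℤ => M.exists_extend fun h =>
    ((M.proj (h + m)).comp f).comp (M.weight h).subtype
  have key : f = ∑ m ∈ Finset.Icc (-(N : ℤ)) N, F m := by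
    refine end_ext (M := M) fun h w hw => ?_
    have e : ∀ m : ℤ, F m w = M.proj (h + m) (f w) := fun m => hF m h ⟨w, hw⟩
    rw [LinearMap.sum_apply, Finset.sum_congr rfl fun m _ => e m]
    generalize f w = x, hf h w hw = hx
    simp only [iSup_subtype'] at hx
    induction hx using Submodule.iSup_induction' with
    | mem m x hx =>
      rw [Finset.sum_eq_single m.1, proj_of_mem hx]
      · exact fun n _ hn => proj_of_ne (by simpa using fun h' => hn h'.symm) hx
      · exact fun hm => absurd (Finset.mem_Icc.2 (abs_le.1 m.2)) hm
    | zero => simp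
    | add x y _ _ hx hy => simp only [map_add, Finset.sum_add_distrib, ← hx, ← hy]
  rw [key]
  refine sum_mem fun m _ => Submodule.mem_iSup_of_mem m fun h w hw => ?_
  rw [hF m h ⟨w, hw⟩]
  exact M.proj_mem _ _

variable (M) in
theorem complRep_mem_glJ (x : 𝓥.CompletedAlg) : M.complRep x ∈ glJ M.weight := by
  obtain ⟨f, rfl⟩ := Ideal.Quotient.mk_surjective x
  obtain ⟨N, hN⟩ := f.2.1
  refine mem_glJ_of_bounded (N := N) fun h w hw => ?_
  obtain ⟨i, hi⟩ := (limAct_spec M.isLowerTruncated f w).exists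
  change limAct M.isLowerTruncated f w ∈ _
  rw [← hi]
  have hle : bdd 𝓥.deg N ≤ (⨆ m : ℤ, ⨆ _ : |m| ≤ (N : ℤ), M.weight (h + m)).comap
      ((LinearMap.applyₗ w).comp M.freeRep.toLinearMap) :=
    iSup₂_le fun m hm a ha => Submodule.mem_iSup_of_mem m
      (Submodule.mem_iSup_of_mem hm (M.deg_mem_weight ha hw))
  exact hle (hN i)

variable (M) in
theorem rep_mem_glJ (a : 𝓥.Enveloping) : M.rep a ∈ glJ M.weight := by
  obtain ⟨x, rfl⟩ := RingQuot.mkAlgHom_surjective ℂ 𝓥.JacRel a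
  rw [rep_mk]
  exact M.complRep_mem_glJ x

end WeightDecomposition

section Irreducible

variable {W : Type*} [AddCommGroup W] [Module ℂ W] {M : VOAModule 𝓥 W}

/-! ### Irreducible modules -/

/-- The weights of an irreducible module lie in `h₀ + ℕ` for a lowest weight `h₀`. -/
theorem IsIrreducible.exists_lowest_weight (hM : M.IsIrreducible) :
    ∃ h₀ : ℂ, M.weight h₀ ≠ ⊥ ∧ ∀ h, M.weight h ≠ ⊥ → ∃ n : ℕ, h = h₀ + n := by
  obtain ⟨hnt, hsub⟩ := hM
  obtain ⟨h₁, hh₁⟩ : ∃ h, M.weight h ≠ ⊥ := by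
    by_contra! H
    have := M.iSup_weight_eq_top
    simp only [H, iSup_bot] at this
    exact bot_ne_top this
  -- The weight spaces in one coset of `ℤ` span a submodule.
  have htop : (⨆ n : ℤ, M.weight (h₁ + n)) = ⊤ := by
    refine (hsub _ fun u n w hw => ?_).resolve_left fun H => hh₁ ?_
    · induction hw using Submodule.iSup_induction' with
      | mem m w hw =>
        induction u using 𝓥.weight_induction with
        | hom p u hu =>
          refine Submodule.mem_iSup_of_mem (m + (p - n - 1)) ?_
          rw [Int.cast_add, ← add_assoc]
          exact M.mode_mem_weight hu n hw
        | zero => simp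
        | add u v hu hv => simpa using add_mem hu hv
      | zero => rw [map_zero]; exact zero_mem _
      | add x y _ _ hx hy => rw [map_add]; exact add_mem hx hy
    · simpa using (iSup_eq_bot.1 H) 0
  have hcoset : ∀ h, M.weight h ≠ ⊥ → ∃ n : ℤ, h = h₁ + n := by
    intro h hh
    by_contra! H
    refine hh (disjoint_top.1 (htop ▸ (M.iSupIndep_weight h).mono_right ?_))
    exact iSup_le fun n => le_iSup₂_of_le (h₁ + n) (H n).symm le_rfl
  obtain ⟨N, hN⟩ := M.truncated h₁
  obtain ⟨n₀, hn₀, hmin⟩ := Int.exists_least_of_bdd (P := fun n : ℤ => M.weight (h₁ + n) ≠ ⊥)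
    ⟨N, fun n hn => not_lt.1 fun hlt => hn (hN n hlt)⟩ ⟨0, by simpa using hh₁⟩
  refine ⟨h₁ + n₀, hn₀, fun h hh => ?_⟩
  obtain ⟨n, rfl⟩ := hcoset h hh
  refine ⟨(n - n₀).toNat, ?_⟩
  have h1 : ((n - n₀).toNat : ℤ) = n - n₀ := Int.toNat_of_nonneg (by linarith [hmin n hh])
  have h2 : ((n - n₀).toNat : ℂ) = n - n₀ := by exact_mod_cast congrArg (Int.cast : ℤ → ℂ) h1
  rw [h2]; ring

variable (M) in
/-- `W` as a module over the free algebra. -/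
noncomputable abbrev freeModule : Module (FreeAlg V) W := Module.compHom W M.freeRep.toRingHom

theorem IsIrreducible.isSimpleModule (hM : M.IsIrreducible) :
    letI := M.freeModule
    IsSimpleModule (FreeAlg V) W := by
  let := M.freeModule
  have hsmul : ∀ (a : FreeAlg V) (w : W), a • w = M.freeRep a w := fun _ _ => rfl
  have : IsScalarTower ℂ (FreeAlg V) W := ⟨fun c a w => by simp [hsmul]⟩
  have := hM.1
  refine (isSimpleModule_iff ..).2 ⟨fun N => ?_⟩
  refine (hM.2 (N.restrictScalars ℂ) fun u n w hw => ?_).imp (fun h => ?_) fun h => ?_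
  · rw [← freeRep_gen]
    exact N.smul_mem (gen u n) hw
  · simpa using h
  · simpa using h

/-- Schur's lemma. The scalar is an eigenvalue of `φ` on a nonzero weight space, which is stable
under `φ` and finite-dimensional. -/
theorem IsIrreducible.exists_eq_smul (hM : M.IsIrreducible) {φ : Module.End ℂ W}
    (hφ : ∀ (u : V) (n : ℤ) (w : W), φ (ncoeff (M.Y u) n w) = ncoeff (M.Y u) n (φ w)) :
    ∃ c : ℂ, ∀ w, φ w = c • w := by
  obtain ⟨h, hh, -⟩ := hM.exists_lowest_weight
  have : FiniteDimensional ℂ (M.weight h) := M.finite_weight h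
  have : Nontrivial (M.weight h) := Submodule.nontrivial_iff_ne_bot.2 hh
  have hstab : ∀ w ∈ M.weight h, φ w ∈ M.weight h := fun w hw => by
    have hw' : ncoeff (M.Y 𝓥.omega) 1 w = h • w := Module.End.mem_eigenspace_iff.1 hw
    refine Module.End.mem_eigenspace_iff.2 ?_
    rw [← hφ, hw', map_smul]
  obtain ⟨c, hc⟩ := Module.End.exists_eigenvalue (φ.restrict hstab)
  obtain ⟨v, hv⟩ := hc.exists_hasEigenvector
  refine ⟨c, ?_⟩
  have hker := hM.2 (LinearMap.ker (φ - c • 1)) fun u n w hw => by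
    rw [LinearMap.mem_ker, LinearMap.sub_apply, sub_eq_zero] at hw ⊢
    rw [hφ, hw]
    simp
  rcases hker with H | H
  · refine absurd (Subtype.ext ?_ : v = 0) hv.2
    have h1 : (v : W) ∈ LinearMap.ker (φ - c • 1) := by
      have := congrArg Subtype.val hv.apply_eq_smul
      simpa [sub_eq_zero] using this
    simpa [H] using h1
  · intro w
    have h1 : w ∈ LinearMap.ker (φ - c • 1) := by rw [H]; trivial
    simpa [sub_eq_zero] using h1

end Irreducible

section Family

variable {r : ℕ} {W : Fin r → Type*} [∀ i, AddCommGroup (W i)] [∀ i, Module ℂ (W i)]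
  {M : ∀ i, VOAModule 𝓥 (W i)}

/-! ### Density -/

/-- Density of the free algebra: finitely many values of any family of endomorphisms of pairwise
inequivalent irreducible modules are attained by a single element of `A`. The commutant of `A` on
`∏ W_i` consists of the families of scalars, so it commutes with all families of endomorphisms. -/
theorem exists_freeRep_eq (hirr : ∀ i, (M i).IsIrreducible)
    (hineq : ∀ i j, i ≠ j → ¬ (M i).IsEquivalent (M j)) (g : ∀ i, Module.End ℂ (W i))
    (s : ∀ i, Finset (W i)) :
    ∃ a : FreeAlg V, ∀ i, ∀ w ∈ s i, (M i).freeRep a w = g i w := by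
  classical
  let _ : ∀ i, Module (FreeAlg V) (W i) := fun i => (M i).freeModule
  have hsmul : ∀ i (a : FreeAlg V) (w : W i), a • w = (M i).freeRep a w := fun _ _ _ => rfl
  have : ∀ i, IsSimpleModule (FreeAlg V) (W i) := fun i => (hirr i).isSimpleModule
  have hgen : ∀ i j (ψ : W i →ₗ[FreeAlg V] W j) (u : V) (n : ℤ) (w : W i),
      ψ (ncoeff ((M i).Y u) n w) = ncoeff ((M j).Y u) n (ψ w) := fun i j ψ u n w => by
    rw [← freeRep_gen, ← freeRep_gen]
    exact ψ.map_smul (gen u n) w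
  have hlin : ∀ i j (ψ : W i →ₗ[FreeAlg V] W j) (c : ℂ) (w : W i), ψ (c • w) = c • ψ w :=
    fun i j ψ c w => by
      simpa [hsmul] using ψ.map_smul (algebraMap ℂ (FreeAlg V) c) w
  have hoff : ∀ i j, i ≠ j → ∀ ψ : W i →ₗ[FreeAlg V] W j, ψ = 0 := fun i j hij ψ =>
    (LinearMap.bijective_or_eq_zero ψ).resolve_left fun hb => hineq i j hij
      ⟨{ LinearEquiv.ofBijective ψ hb with map_smul' := hlin i j ψ }, hgen i j ψ⟩
  have hdiag : ∀ i (ψ : W i →ₗ[FreeAlg V] W i), ∃ c : ℂ, ∀ w, ψ w = c • w := fun i ψ =>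
    (hirr i).exists_eq_smul (φ := { ψ with map_smul' := hlin i i ψ }) (hgen i i ψ)
  let B (φ : Module.End (FreeAlg V) (∀ i, W i)) (i j : Fin r) : W i →ₗ[FreeAlg V] W j :=
    (LinearMap.proj j).comp (φ.comp (LinearMap.single (FreeAlg V) W i))
  have hφ : ∀ (φ : Module.End (FreeAlg V) (∀ i, W i)) (j : Fin r), ∃ c : ℂ,
      ∀ x, φ x j = c • x j := fun φ j => by
    obtain ⟨c, hc⟩ := hdiag j (B φ j j)
    refine ⟨c, fun x => ?_⟩
    rw [← hc]
    conv_lhs => rw [← LinearMap.sum_single_apply W x, map_sum, Finset.sum_apply]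
    exact Finset.sum_eq_single j
      (fun i _ hij => LinearMap.congr_fun (hoff i j hij (B φ i j)) (x i)) (by simp)
  let f : Module.End (Module.End (FreeAlg V) (∀ i, W i)) (∀ i, W i) :=
    { toFun := fun x i => g i (x i)
      map_add' := fun x y => by ext i; simp
      map_smul' := fun φ x => by
        ext j
        obtain ⟨c, hc⟩ := hφ φ j
        change g j (φ x j) = φ (fun i => g i (x i)) j
        rw [hc, hc, map_smul] }
  obtain ⟨a, ha⟩ := jacobson_density f
    (Finset.univ.biUnion fun i => (s i).image fun w => Pi.single i w)
  refine ⟨a, fun i w hw => ?_⟩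
  have h1 := congrFun (ha (Pi.single i w) (Finset.mem_biUnion.2
    ⟨i, Finset.mem_univ _, Finset.mem_image_of_mem _ hw⟩)) i
  have h2 : g i ((Pi.single i w : ∀ i, W i) i) = a • (Pi.single i w : ∀ i, W i) i := h1
  rw [Pi.single_eq_same] at h2
  exact h2.symm

/-- Homogeneous density: a family of endomorphisms of degree `d` is realized on finitely many weight
spaces by an element of `A_d`. -/
theorem exists_deg_freeRep_eq (hirr : ∀ i, (M i).IsIrreducible)
    (hineq : ∀ i j, i ≠ j → ¬ (M i).IsEquivalent (M j)) {d : ℤ} {g : ∀ i, Module.End ℂ (W i)}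
    (hg : ∀ i, g i ∈ glJDeg (M i).weight d) (T : Fin r → Finset ℂ) :
    ∃ a ∈ 𝓥.deg d, ∀ i, ∀ h ∈ T i, ∀ w ∈ (M i).weight h, (M i).freeRep a w = g i w := by
  classical
  have hfg : ∀ i h, ∃ s : Finset (W i), Submodule.span ℂ (s : Set (W i)) = (M i).weight h :=
    fun i h => (Submodule.fg_iff_finiteDimensional _).2 ((M i).finite_weight h)
  choose s hs using hfg
  obtain ⟨a, ha⟩ := exists_freeRep_eq hirr hineq g fun i => (T i).biUnion (s i)
  have hag : ∀ i, ∀ h ∈ T i, ∀ w ∈ (M i).weight h, (M i).freeRep a w = g i w := by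
    intro i h hh w hw
    rw [← hs] at hw
    exact LinearMap.eqOn_span (fun x hx => ha i x (Finset.mem_biUnion.2 ⟨h, hh, hx⟩)) hw
  obtain ⟨S, f, hf, rfl⟩ := 𝓥.exists_eq_sum_deg a
  -- The component of degree `d` has the same values, by comparing weights.
  refine ⟨if d ∈ S then f d else 0, by split_ifs; exacts [hf d, zero_mem _], fun i h hh w hw => ?_⟩
  have h1 := congrArg ((M i).proj (h + d)) (hag i h hh w hw)
  rw [proj_of_mem (hg i h w hw)] at h1
  rw [← h1, map_sum, LinearMap.sum_apply, map_sum, ← Finset.sum_ite_eq S d f, map_sum,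
    LinearMap.sum_apply]
  refine Finset.sum_congr rfl fun m _ => ?_
  have hm := (M i).deg_mem_weight (hf m) hw
  split_ifs with hdm
  · subst hdm; rw [proj_of_mem hm]
  · rw [map_zero, LinearMap.zero_apply, proj_of_ne _ hm]
    simpa using fun h' => hdm h'.symm

end Family

section Family

variable {r : ℕ} {W : Fin r → Type*} [∀ i, AddCommGroup (W i)] [∀ i, Module ℂ (W i)]
  {M : ∀ i, VOAModule 𝓥 (W i)}

/-! ### Approximation by elements of `A_{n,k}` -/

theorem smulRight_proj_mem_glJDeg (i : Fin r) (φ : W i →ₗ[ℂ] ℂ) {h : ℂ} {d : ℤ} {x : W i}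
    (hx : x ∈ (M i).weight (h + d)) (j : Fin r) :
    (Pi.single i ((φ.comp ((M i).proj h)).smulRight x) : ∀ i, Module.End ℂ (W i)) j ∈
      glJDeg (M j).weight d := by
  by_cases hj : j = i
  · subst hj
    rw [Pi.single_eq_same]
    intro h' w hw
    by_cases hh : h' = h
    · subst hh; exact Submodule.smul_mem _ _ hx
    · simp [proj_of_ne hh hw]
  · rw [Pi.single_eq_of_ne hj]; exact zero_mem _

/-- A rank one operator supported on a weight space `t` steps above the lowest one factors through
the lowest weight space, so it is approximated by elements of `A_{n+t} A_{-t}`. -/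
theorem exists_mem_sub_rank_one (hirr : ∀ i, (M i).IsIrreducible)
    (hineq : ∀ i j, i ≠ j → ¬ (M i).IsEquivalent (M j)) {h₀ : Fin r → ℂ}
    (hne : ∀ i, (M i).weight (h₀ i) ≠ ⊥) {n k : ℤ} {t : ℕ} (hk : k < t) (i : Fin r)
    (φ : W i →ₗ[ℂ] ℂ) {x : W i} (hx : x ∈ (M i).weight (h₀ i + t + n)) :
    ∃ a ∈ sub 𝓥.deg n k, ∀ j, ∀ s ≤ t, ∀ w ∈ (M j).weight (h₀ j + s), (M j).freeRep a w =
      (Pi.single i ((φ.comp ((M i).proj (h₀ i + t))).smulRight x) :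
        ∀ i, Module.End ℂ (W i)) j w := by
  classical
  obtain ⟨w₀, hw₀, hw₀'⟩ := Submodule.exists_mem_ne_zero_of_ne_bot (hne i)
  obtain ⟨φ₀, hφ₀⟩ : ∃ φ₀ : W i →ₗ[ℂ] ℂ, φ₀ w₀ = 1 :=
    Module.Projective.exists_dual_eq_one ℂ hw₀'
  obtain ⟨c, hc, hc'⟩ := exists_deg_freeRep_eq hirr hineq (d := -(t : ℤ))
    (smulRight_proj_mem_glJDeg (M := M) i φ (h := h₀ i + t) (x := w₀) (by simpa using hw₀))
    fun j => (Finset.range (t + 1)).image fun s : ℕ => h₀ j + s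
  obtain ⟨b, hb, hb'⟩ := exists_deg_freeRep_eq hirr hineq (d := n + t)
    (smulRight_proj_mem_glJDeg (M := M) i φ₀ (h := h₀ i) (x := x)
      (by push_cast; rwa [add_comm (n : ℂ), ← add_assoc])) fun j => {h₀ j}
  refine ⟨b * c, Submodule.mem_iSup_of_mem (t : ℤ) (Submodule.mem_iSup_of_mem hk
    (Submodule.mul_mem_mul hb hc)), fun j s hs w hw => ?_⟩
  have h1 := hc' j (h₀ j + s) (Finset.mem_image.2 ⟨s, by simpa [Nat.lt_succ_iff] using hs, rfl⟩) w hw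
  rw [map_mul, Module.End.mul_apply, h1]
  by_cases hj : j = i
  · subst hj
    have h2 := hb' j (h₀ j) (by simp) w₀ hw₀
    simp only [Pi.single_eq_same, LinearMap.smulRight_apply, LinearMap.comp_apply,
      proj_of_mem hw₀, hφ₀, one_smul] at h2 ⊢
    rw [map_smul, h2]
  · simp [Pi.single_eq_of_ne hj]

/-- The correction on one level: a family that vanishes below the level `t > k` is realized up to
that level by an element of `A_{n,k}`. -/
theorem exists_mem_sub_freeRep_eq (hirr : ∀ i, (M i).IsIrreducible)
    (hineq : ∀ i j, i ≠ j → ¬ (M i).IsEquivalent (M j)) {h₀ : Fin r → ℂ}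
    (hne : ∀ i, (M i).weight (h₀ i) ≠ ⊥) {n k : ℤ} {t : ℕ} (hk : k < t)
    {f : ∀ i, Module.End ℂ (W i)} (hf : ∀ i, f i ∈ glJDeg (M i).weight n)
    (hvan : ∀ i, ∀ s < t, ∀ w ∈ (M i).weight (h₀ i + s), f i w = 0) :
    ∃ a ∈ sub 𝓥.deg n k, ∀ i, ∀ s ≤ t, ∀ w ∈ (M i).weight (h₀ i + s),
      (M i).freeRep a w = f i w := by
  classical
  have : ∀ i, FiniteDimensional ℂ ((M i).weight (h₀ i + t)) := fun i => (M i).finite_weight _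
  let β i := Module.finBasis ℂ ((M i).weight (h₀ i + t))
  let p i : W i →ₗ[ℂ] (M i).weight (h₀ i + t) :=
    ((M i).proj (h₀ i + t)).codRestrict _ ((M i).proj_mem _)
  choose a ha ha' using fun i l => exists_mem_sub_rank_one hirr hineq hne hk i
    (((β i).coord l).comp (p i)) (hf i _ _ (β i l).2)
  refine ⟨∑ i, ∑ l, a i l, sum_mem fun i _ => sum_mem fun l _ => ha i l, fun i s hs w hw => ?_⟩
  simp only [map_sum, LinearMap.sum_apply]
  rw [Finset.sum_eq_single i
    (fun j _ hj => Finset.sum_eq_zero fun l _ => by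
      rw [ha' j l i s hs w hw, Pi.single_eq_of_ne hj.symm, LinearMap.zero_apply]) (by simp)]
  simp only [ha' i _ i s hs w hw, Pi.single_eq_same, LinearMap.smulRight_apply,
    LinearMap.comp_apply, Module.Basis.coord_apply]
  rcases hs.lt_or_eq with hlt | rfl
  · rw [hvan i s hlt w hw]
    refine Finset.sum_eq_zero fun l _ => ?_
    rw [proj_of_ne _ hw]
    · simp
    · simpa using hlt.ne
  · have hp : p i w = ⟨w, hw⟩ := Subtype.ext (proj_of_mem hw)
    rw [proj_of_mem hw, hp]
    have hrepr : w = ∑ l, (β i).repr ⟨w, hw⟩ l • (β i l : W i) := by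
      have h1 := congrArg ((M i).weight (h₀ i + s)).subtype ((β i).sum_repr ⟨w, hw⟩)
      rw [map_sum] at h1
      exact h1.symm
    conv_rhs => rw [hrepr, map_sum]
    simp

/-- A family of degree `n` that vanishes below the level `t₀ > k` is the limit of a Cauchy sequence
in `A_{n,k}`, built by correcting one level at a time. -/
theorem exists_cauchySeq_seqRep_eq (hirr : ∀ i, (M i).IsIrreducible)
    (hineq : ∀ i j, i ≠ j → ¬ (M i).IsEquivalent (M j)) {h₀ : Fin r → ℂ}
    (hne : ∀ i, (M i).weight (h₀ i) ≠ ⊥)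
    (hlow : ∀ i h, (M i).weight h ≠ ⊥ → ∃ s : ℕ, h = h₀ i + s) {n k : ℤ} {t₀ : ℕ} (hk : k < t₀)
    {f : ∀ i, Module.End ℂ (W i)} (hf : ∀ i, f i ∈ glJDeg (M i).weight n)
    (hvan : ∀ i, ∀ s < t₀, ∀ w ∈ (M i).weight (h₀ i + s), f i w = 0) :
    ∃ F : cauchySeq 𝓥.deg, (∀ j, F.1 j ∈ sub 𝓥.deg n k) ∧
      ∀ i, seqRep (M i).isLowerTruncated F = f i := by
  let P (j : ℕ) (a : FreeAlg V) : Prop := a ∈ sub 𝓥.deg n k ∧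
    ∀ i, ∀ s < t₀ + j, ∀ w ∈ (M i).weight (h₀ i + s), (M i).freeRep a w = f i w
  have step : ∀ j (a : {a // P j a}), ∃ b : {b // P (j + 1) b},
      b.1 - a.1 ∈ sub 𝓥.deg n (k + j) := by
    rintro j ⟨a, ha, ha'⟩
    obtain ⟨d, hd, hd'⟩ := exists_mem_sub_freeRep_eq hirr hineq hne (n := n) (k := k + j)
      (t := t₀ + j) (by push_cast; lia) (f := fun i => f i - (M i).freeRep a)
      (fun i => sub_mem (hf i) fun h w hw => (M i).deg_mem_weight (𝓥.sub_le_deg n k ha) hw)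
      (fun i s hs w hw => by rw [LinearMap.sub_apply, ha' i s hs w hw, sub_self])
    refine ⟨⟨a + d, add_mem ha (sub_anti n (by lia) hd), fun i s hs w hw => ?_⟩, by simpa using hd⟩
    rw [map_add, LinearMap.add_apply, hd' i s (by lia) w hw, LinearMap.sub_apply, add_sub_cancel]
  choose next hnext using step
  obtain ⟨a, ha⟩ : ∃ a : ∀ j, {a // P j a}, ∀ j : ℕ, (a (j + 1)).1 - (a j).1 ∈ sub 𝓥.deg n (k + j) :=
    ⟨fun j => Nat.rec ⟨0, zero_mem _, fun i s hs w hw => by rw [hvan i s hs w hw]; simp⟩ next j,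
      fun j => hnext j _⟩
  have hdiff : ∀ i j : ℕ, j ≤ i → (a i).1 - (a j).1 ∈ sub 𝓥.deg n (k + j) := by
    intro i j hij
    induction i, hij using Nat.le_induction with
    | base => simp
    | succ i hij ih =>
      have h1 : (a (i + 1)).1 - (a i).1 ∈ sub 𝓥.deg n (k + j) :=
        sub_anti n (by lia) (ha i)
      simpa using add_mem h1 ih
  have hcau : IsCauchySeq 𝓥.deg fun j => (a j).1 := by
    refine ⟨⟨_, fun j => le_bdd n (𝓥.sub_le_deg n k (a j).2.1)⟩, fun l => ?_⟩
    have key : ∀ i, (l - k).toNat ≤ i → (a i).1 - (a (l - k).toNat).1 ∈ nhd 𝓥.deg l :=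
      fun i hi => le_iSup (fun m => sub 𝓥.deg m l) n (sub_anti n (by lia) (hdiff i _ hi))
    exact ⟨(l - k).toNat, fun i hi j hj => by simpa using sub_mem (key i hi) (key j hj)⟩
  refine ⟨⟨_, hcau⟩, fun j => (a j).2.1, fun i => end_ext (M := M i) fun h w hw => ?_⟩
  by_cases hb : (M i).weight h = ⊥
  · rw [hb, Submodule.mem_bot] at hw
    simp [hw]
  · obtain ⟨s, rfl⟩ := hlow i h hb
    exact limAct_eq (M i).isLowerTruncated (eventually_atTop.2
      ⟨s + 1, fun j hj => (a j).2.2 i s (by lia) w hw⟩)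

end Family

/-! ### The action on a family of modules -/

section Continuity

variable {W : Type*} [AddCommGroup W] [Module ℂ W] (M : VOAModule 𝓥 W)

theorem rep_mem_glJDeg {n : ℤ} {a : 𝓥.Enveloping} (ha : a ∈ 𝓥.envDeg n) :
    M.rep a ∈ glJDeg M.weight n := by
  obtain ⟨_, ⟨F, hF, rfl⟩, rfl⟩ := ha
  intro h w hw
  obtain ⟨i, hi⟩ := (limAct_spec M.isLowerTruncated F w).exists
  change M.rep (RingQuot.mkAlgHom ℂ 𝓥.JacRel _) w ∈ _
  rw [rep_mk]
  change limAct M.isLowerTruncated F w ∈ _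
  rw [← hi]
  exact M.deg_mem_weight (hF i) hw

theorem envNhd_le_envDeg (n k : ℤ) : 𝓥.envNhd n k ≤ 𝓥.envDeg n :=
  Submodule.map_mono fun _ ⟨F, hF, hx⟩ => ⟨F, fun i => 𝓥.sub_le_deg n k (hF i), hx⟩

theorem exists_rep_eq_zero_of_mem_envNhd (n : ℤ) (h : ℂ) :
    ∃ k₀ : ℤ, ∀ k, k₀ ≤ k → ∀ a ∈ 𝓥.envNhd n k, ∀ w ∈ M.weight h, M.rep a w = 0 := by
  obtain ⟨N, hN⟩ := M.truncated h
  refine ⟨-N, fun k hk => ?_⟩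
  rintro _ ⟨_, ⟨F, hF, rfl⟩, rfl⟩ w hw
  have hle : sub 𝓥.deg n k ≤ LinearMap.ker ((LinearMap.applyₗ w).comp M.freeRep.toLinearMap) := by
    refine iSup₂_le fun p hp => Submodule.mul_le.2 fun x _ y hy => ?_
    have h1 := M.deg_mem_weight hy hw
    rw [weight, hN (-p) (by lia), Submodule.mem_bot] at h1
    simp [h1]
  change M.rep (RingQuot.mkAlgHom ℂ 𝓥.JacRel _) w = 0
  rw [rep_mk]
  exact limAct_eq M.isLowerTruncated (.of_forall fun i => hle (hF i))

end Continuity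

section Family

variable {r : ℕ} {W : Fin r → Type*} [∀ i, AddCommGroup (W i)] [∀ i, Module ℂ (W i)]
  (M : ∀ i, VOAModule 𝓥 (W i))

/-- The homomorphism `U(V) → gl_J(W_1) ⊕ ⋯ ⊕ gl_J(W_r)` given by the actions. -/
noncomputable def prodRep : 𝓥.Enveloping →ₐ[ℂ] (∀ i, glJ (M i).weight) :=
  AlgHom.pi fun i => (M i).rep.codRestrict _ (M i).rep_mem_glJ

theorem coe_prodRep (a : 𝓥.Enveloping) (i : Fin r) :
    (prodRep M a i : Module.End ℂ (W i)) = (M i).rep a := rfl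

theorem mem_iInf_annihilator {a : 𝓥.Enveloping} :
    a ∈ ⨅ i, (M i).annihilator ↔ prodRep M a = 0 := by
  rw [Ideal.mem_iInf, funext_iff]
  exact forall_congr' fun i => (RingHom.mem_ker (f := (M i).rep)).trans
    (Subtype.ext_iff (a1 := prodRep M a i) (a2 := 0)).symm

variable {M}

theorem exists_mem_envNhd_rep_eq (hirr : ∀ i, (M i).IsIrreducible)
    (hineq : ∀ i j, i ≠ j → ¬ (M i).IsEquivalent (M j)) {h₀ : Fin r → ℂ}
    (hne : ∀ i, (M i).weight (h₀ i) ≠ ⊥)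
    (hlow : ∀ i h, (M i).weight h ≠ ⊥ → ∃ s : ℕ, h = h₀ i + s) {n k : ℤ} {t₀ : ℕ} (hk : k < t₀)
    {f : ∀ i, Module.End ℂ (W i)} (hf : ∀ i, f i ∈ glJDeg (M i).weight n)
    (hvan : ∀ i, ∀ s < t₀, ∀ w ∈ (M i).weight (h₀ i + s), f i w = 0) :
    ∃ a ∈ 𝓥.envNhd n k, ∀ i, (M i).rep a = f i := by
  obtain ⟨F, hF, hF'⟩ := exists_cauchySeq_seqRep_eq hirr hineq hne hlow hk hf hvan
  exact ⟨_, ⟨_, ⟨F, hF, rfl⟩, rfl⟩, fun i => ((M i).rep_mk _).trans (hF' i)⟩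

theorem exists_mem_envDeg_rep_eq (hirr : ∀ i, (M i).IsIrreducible)
    (hineq : ∀ i j, i ≠ j → ¬ (M i).IsEquivalent (M j)) {n : ℤ}
    {f : ∀ i, Module.End ℂ (W i)} (hf : ∀ i, f i ∈ glJDeg (M i).weight n) :
    ∃ a ∈ 𝓥.envDeg n, ∀ i, (M i).rep a = f i := by
  choose h₀ hne hlow using fun i => (hirr i).exists_lowest_weight
  -- No levels lie below `0`, so `k = -1` is allowed.
  obtain ⟨a, ha, ha'⟩ := exists_mem_envNhd_rep_eq hirr hineq hne hlow (k := -1) (t₀ := 0) (by lia)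
    hf (fun _ _ hs => absurd hs (Nat.not_lt_zero _))
  exact ⟨a, envNhd_le_envDeg n _ ha, ha'⟩

theorem prodRep_surjective (hirr : ∀ i, (M i).IsIrreducible)
    (hineq : ∀ i j, i ≠ j → ¬ (M i).IsEquivalent (M j)) : Function.Surjective (prodRep M) := by
  classical
  suffices H : ∀ i, ∀ f ∈ ⨆ k : ℤ, glJDeg (M i).weight k,
      ∃ a, ∀ j, (M j).rep a = (Pi.single i f : ∀ i, Module.End ℂ (W i)) j by
    intro x
    choose a ha using fun i => H i (x i).1 (x i).2
    refine ⟨∑ i, a i, funext fun j => Subtype.ext ?_⟩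
    rw [coe_prodRep, map_sum, Finset.sum_congr rfl fun i _ => ha i j, ← Finset.sum_apply,
      Finset.univ_sum_single]
  intro i f hf
  induction hf using Submodule.iSup_induction' with
  | mem k f hf =>
    obtain ⟨a, -, ha⟩ := exists_mem_envDeg_rep_eq hirr hineq (n := k)
      (f := (Pi.single i f : ∀ i, Module.End ℂ (W i))) fun j => by
        by_cases hj : j = i
        · subst hj; rwa [Pi.single_eq_same]
        · rw [Pi.single_eq_of_ne hj]; exact zero_mem _
    exact ⟨a, ha⟩
  | zero => exact ⟨0, fun j => by simp⟩
  | add f g _ _ hf hg =>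
    obtain ⟨a, ha⟩ := hf
    obtain ⟨b, hb⟩ := hg
    exact ⟨a + b, fun j => by rw [map_add, ha, hb, Pi.single_add, Pi.add_apply]⟩

end Family

end VOAModule

theorem mainTheorem10 {V : Type*} [AddCommGroup V] [Module ℂ V] (𝓥 : VertexOperatorAlgebra V)
    {r : ℕ} (W : Fin r → Type*) [∀ i, AddCommGroup (W i)] [∀ i, Module ℂ (W i)]
    (M : ∀ i, VOAModule 𝓥 (W i)) (hirr : ∀ i, (M i).IsIrreducible)
    (hineq : ∀ i j, i ≠ j → ¬ (M i).IsEquivalent (M j)) :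
    ∃ e : (𝓥.Enveloping ⧸ ⨅ i, (M i).annihilator) ≃ₐ[ℂ] (∀ i, glJ (M i).weight),
      -- `e` is induced by the actions of `U(V)` on the modules
      (∀ (a : 𝓥.Enveloping) (i : Fin r),
        (e (Ideal.Quotient.mk _ a) i : Module.End ℂ (W i)) = (M i).rep a) ∧
      -- `e` preserves the `ℤ`-gradings
      (∀ (n : ℤ) (x : 𝓥.Enveloping ⧸ ⨅ i, (M i).annihilator),
        (∃ a ∈ 𝓥.envDeg n, Ideal.Quotient.mk _ a = x) ↔
          ∀ i, (e x i : Module.End ℂ (W i)) ∈ glJDeg (M i).weight n) ∧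
      -- `e` is continuous in each degree
      (∀ (n : ℤ) (S : Finset ℂ), ∃ k : ℤ, ∀ a ∈ 𝓥.envNhd n k, ∀ i,
        (e (Ideal.Quotient.mk _ a) i : Module.End ℂ (W i)) ∈ glJNhd (M i).weight n S) ∧
      -- `e` is open in each degree
      (∀ n k : ℤ, ∃ S : Finset ℂ, ∀ x : 𝓥.Enveloping ⧸ ⨅ i, (M i).annihilator,
        (∀ i, (e x i : Module.End ℂ (W i)) ∈ glJNhd (M i).weight n S) →
          ∃ a ∈ 𝓥.envNhd n k, Ideal.Quotient.mk _ a = x) := by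
  choose h₀ hne hlow using fun i => (hirr i).exists_lowest_weight
  let φ : (𝓥.Enveloping ⧸ ⨅ i, (M i).annihilator) →ₐ[ℂ] (∀ i, glJ (M i).weight) :=
    Ideal.Quotient.liftₐ _ (VOAModule.prodRep M)
      fun a ha => (VOAModule.mem_iInf_annihilator M).1 ha
  have hinj : Function.Injective φ := (injective_iff_map_eq_zero φ).2 fun x hx => by
    obtain ⟨a, rfl⟩ := Ideal.Quotient.mk_surjective x
    exact Ideal.Quotient.eq_zero_iff_mem.2 ((VOAModule.mem_iInf_annihilator M).2 hx)
  have hsurj : Function.Surjective φ := fun x => by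
    obtain ⟨a, ha⟩ := VOAModule.prodRep_surjective hirr hineq x
    exact ⟨Ideal.Quotient.mk _ a, ha⟩
  have hφ : ∀ a i, (φ (Ideal.Quotient.mk _ a) i : Module.End ℂ (W i)) = (M i).rep a :=
    fun _ _ => rfl
  have hlift : ∀ (a : 𝓥.Enveloping) (x : 𝓥.Enveloping ⧸ ⨅ i, (M i).annihilator),
      (∀ i, (M i).rep a = φ x i) → Ideal.Quotient.mk _ a = x := fun a x h =>
    hinj (funext fun i => Subtype.ext (h i))
  refine ⟨AlgEquiv.ofBijective φ ⟨hinj, hsurj⟩, hφ, fun n x => ⟨?_, fun hx => ?_⟩, fun n S => ?_,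
    fun n k => ?_⟩
  · rintro ⟨a, ha, rfl⟩ i
    exact (M i).rep_mem_glJDeg ha
  · obtain ⟨a, ha, ha'⟩ := VOAModule.exists_mem_envDeg_rep_eq hirr hineq hx
    exact ⟨a, ha, hlift a x ha'⟩
  · choose κ hκ using fun i h => (M i).exists_rep_eq_zero_of_mem_envNhd n h
    obtain ⟨k, hk⟩ := ((Finset.univ ×ˢ S).image fun p : Fin r × ℂ => κ p.1 p.2).exists_le
    refine ⟨k, fun a ha i => ⟨(M i).rep_mem_glJDeg (VOAModule.envNhd_le_envDeg n k ha),
      fun h hh => hκ i h k (hk _ (Finset.mem_image.2 ⟨(i, h), by simpa using hh, rfl⟩)) a ha⟩⟩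
  · -- Vanishing on the levels `0, …, k` of every module is enough.
    refine ⟨Finset.univ.biUnion fun i => (Finset.range (k + 1).toNat).image fun s : ℕ => h₀ i + s,
      fun x hx => ?_⟩
    obtain ⟨a, ha, ha'⟩ := VOAModule.exists_mem_envNhd_rep_eq hirr hineq hne hlow
      (k := k) (t₀ := (k + 1).toNat) (by lia) (fun i => (hx i).1) fun i s hs => (hx i).2 _
        (Finset.mem_biUnion.2 ⟨i, Finset.mem_univ _, Finset.mem_image_of_mem _
          (Finset.mem_range.2 hs)⟩)
    exact ⟨a, ha, hlift a x ha'⟩
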